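/- Fix an integer $N \ge 1$. Let $I=[0,1]$ with its Borel $\sigma$-algebra $\mathcal B_I$, let $\Lambda=\{N,N+1,\dots\}$, and for $x\in I$, $i\in\Lambda$ put $$u(x,i)=\frac{N}{x+i},\qquad P(x,i)=\frac{x+N}{(x+i)(x+i+1)} .$$ Then $\{(I,\mathcal B_I),\Lambda,u,P\}$ is a random system with complete connections (that is, $u(\cdot,i):I\to I$ and $P(\cdot,i):I\to[0,1]$ are measurable for each $i\in\Lambda$, and $\sum_{i\in\Lambda}P(x,i)=1$ for each $x\in I$), and it is uniformly ergodic in the following sense. For a string $i_1\cdots i_r\in\Lambda^r$ let $x\,i_1\cdots i_r$ denote the state obtained from $x$ by applying $u(\cdot,i_1),\dots,u(\cdot,i_r)$ successively. Set $P_1=P$ and $P_r(x,i_1\cdots i_r)=P_{r-1}(x,i_1\cdots i_{r-1})\,P(x\,i_1\cdots i_{r-1},\,i_r)$ for $r\ge2$. For $A\subseteq\Lambda^r$ let $P_r(x,A)=\sum_{a\in A}P_r(x,a)$, and for $n\ge1$ let $P_r^n(x,A)=P_{r+n-1}(x,\Lambda^{n-1}\times A)$, where $\Lambda^0\times A=A$.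 Then there exist probability measures $P_r^\infty$ on $(\Lambda^r,\mathcal P(\Lambda^r))$, $r\ge1$, such that $$\varepsilon_n:=\sup\bigl\{\,|P_r^n(x,A)-P_r^\infty(A)| : x\in I,\ r\ge 1,\ A\subseteq\Lambda^r\,\bigr\}\longrightarrow 0\qquad(n\to\infty).$$ -/

import Mathlib

open MeasureTheory Filter Topology
open scoped ENNReal

/-- A random system with complete connections with state space `W` and event space `X`
(the latter carrying its power set as sigma-algebra): a transition function `u`, measurable in
the state, and a transition probability function `P`, measurable in the state, such that
`P w` is a probability mass function on `X` for every state `w`. -/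
structure RSCC (W X : Type*) [MeasurableSpace W] where
  nonempty_events : Nonempty X
  u : W → X → W
  measurable_u : ∀ x, Measurable fun w => u w x
  P : W → X → ℝ
  P_nonneg : ∀ w x, 0 ≤ P w x
  hasSum_P : ∀ w, HasSum (P w) 1
  measurable_P : ∀ x, Measurable fun w => P w x

namespace RSCC

variable {W X : Type*} [MeasurableSpace W] (S : RSCC W X)

/-- The transition probabilities lie in `[0,1]`. -/
theorem P_le_one (w : W) (x : X) : S.P w x ≤ 1 :=
  le_hasSum (S.hasSum_P w) x fun y _ => S.P_nonneg w y

/-- The right action `w x₁ ⋯ x_r` on states of strings of length `r`; strings of length `r`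
are functions `Fin r → X`. One has `w (x x') = u (w x, x')`. -/
def act : (r : ℕ) → W → (Fin r → X) → W
  | 0, w, _ => w
  | r + 1, w, x => S.u (act r w (Fin.init x)) (x (Fin.last r))

/-- The probability `P_r(w, x)` of the path from `w` along the string `x` of length `r`:
`P_r(w, x x') = P_{r-1}(w, x) P(w x, x')` and `P_1 = P` (the empty string has probability `1`). -/
def pathProb : (r : ℕ) → W → (Fin r → X) → ℝ
  | 0, _, _ => 1
  | r + 1, w, x =>
      pathProb r w (Fin.init x) * S.P (S.act r w (Fin.init x)) (x (Fin.last r))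

theorem pathProb_one (w : W) (x : Fin 1 → X) : S.pathProb 1 w x = S.P w (x 0) := by
  simp [pathProb, act]

theorem pathProb_nonneg (r : ℕ) (w : W) (x : Fin r → X) : 0 ≤ S.pathProb r w x := by
  induction r with
  | zero => simp [pathProb]
  | succ r ih => exact mul_nonneg (ih _) (S.P_nonneg _ _)

/-- `P_r(w, ·)` is a probability mass function, so the sums below all converge. -/
theorem hasSum_pathProb (r : ℕ) (w : W) : HasSum (S.pathProb r w) 1 := by
  induction r with
  | zero => simp [pathProb]
  | succ r ih =>
    rw [← (Fin.snocEquiv fun _ : Fin (r + 1) => X).hasSum_iff,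
      ← (Equiv.prodComm (Fin r → X) X).hasSum_iff]
    have h : ∀ y : Fin r → X, HasSum (fun x : X => S.pathProb r w y * S.P (S.act r w y) x)
        (S.pathProb r w y) := fun y => by
      simpa using (S.hasSum_P (S.act r w y)).mul_left (S.pathProb r w y)
    have hs : Summable fun p : (Fin r → X) × X =>
        S.pathProb r w p.1 * S.P (S.act r w p.1) p.2 := by
      rw [summable_prod_of_nonneg
        fun p => mul_nonneg (S.pathProb_nonneg r w p.1) (S.P_nonneg _ _)]
      exact ⟨fun y => (h y).summable, by simpa [(h _).tsum_eq] using ih.summable⟩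
    have := (hs.hasSum.prod_fiberwise h).unique ih
    rw [← this]
    convert hs.hasSum using 1
    funext p
    simp [pathProb, Fin.snocEquiv, Function.comp]

/-- `P_r(w, A) = ∑_{x ∈ A} P_r(w, x)` for a set `A` of strings of length `r`. -/
noncomputable def pathProbSet (r : ℕ) (w : W) (A : Set (Fin r → X)) : ℝ :=
  ∑' x : A, S.pathProb r w x

/-- `P_r^n(w, A) = P_{r+n-1}(w, X^{n-1} × A)` for `n ≥ 1`: the probability, starting from `w`,
that the `r` events number `n, …, n + r - 1` form a string in `A`. -/
noncomputable def delayedProb (n r : ℕ) (w : W) (A : Set (Fin r → X)) : ℝ :=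
  S.pathProbSet (n - 1 + r) w {x | (fun j : Fin r => x (Fin.natAdd (n - 1) j)) ∈ A}

/-- `ε_n = sup { |P_r^n(w, A) - P_r^∞(A)| : w ∈ W, r ≥ 1, A ⊆ X^r }`, for a family
`Pinf` of measures `P_r^∞` on the power sets of the `X^r`. The supremum is taken in `[0, ∞]`. -/
noncomputable def ergodicError (Pinf : (r : ℕ) → @Measure (Fin r → X) ⊤) (n : ℕ) : ℝ≥0∞ :=
  ⨆ (w : W) (r : ℕ) (_ : 1 ≤ r) (A : Set (Fin r → X)),
    ENNReal.ofReal |S.delayedProb n r w A - (Pinf r A).toReal|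

/-- Uniform ergodicity: there are probability measures `P_r^∞` on `(X^r, power set)`, `r ≥ 1`,
such that `ε_n → 0`. -/
def UniformlyErgodic : Prop :=
  ∃ Pinf : (r : ℕ) → @Measure (Fin r → X) ⊤,
    (∀ r, 1 ≤ r → @IsProbabilityMeasure (Fin r → X) ⊤ (Pinf r)) ∧
      Tendsto (S.ergodicError Pinf) atTop (𝓝 0)

end RSCC

/-- The telescoping identity behind `∑_{i ≥ N} (x + N) / ((x + i) (x + i + 1)) = 1`. -/
theorem hasSum_nCF (N : ℕ) (hN : 1 ≤ N) (x : ℝ) (hx : 0 ≤ x) :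
    HasSum (fun i : Set.Ici N =>
      (x + N) / ((x + ((i : ℕ) : ℝ)) * (x + ((i : ℕ) : ℝ) + 1))) 1 := by
  let e : ℕ ≃ Set.Ici N :=
    { toFun := fun k => ⟨N + k, Nat.le_add_right N k⟩
      invFun := fun i => (i : ℕ) - N
      left_inv := fun k => by simp
      right_inv := fun i => Subtype.ext (Nat.add_sub_cancel' i.2) }
  have hN' : (1 : ℝ) ≤ N := by exact_mod_cast hN
  rw [← e.hasSum_iff, hasSum_iff_tendsto_nat_of_nonneg]
  · have hsum : ∀ n : ℕ, ∑ k ∈ Finset.range n, ((fun i : Set.Ici N =>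
        (x + N) / ((x + ((i : ℕ) : ℝ)) * (x + ((i : ℕ) : ℝ) + 1))) ∘ e) k
          = 1 - (x + N) / (x + N + n) := by
      intro n
      induction n with
      | zero =>
        have : x + N ≠ 0 := by positivity
        simp [this]
      | succ n ih =>
        rw [Finset.sum_range_succ, ih]
        have h1 : x + N + n ≠ 0 := by positivity
        have h2 : x + N + n + 1 ≠ 0 := by positivity
        simp only [Function.comp, e, Equiv.coe_fn_mk]
        push_cast
        rw [← add_assoc x, ← add_assoc (x + N)]
        field_simp
        ring
    simp only [hsum]
    have : Tendsto (fun n : ℕ => (x + N) / (x + N + n)) atTop (𝓝 0) :=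
      tendsto_const_nhds.div_atTop
        (tendsto_atTop_add_const_left _ _ tendsto_natCast_atTop_atTop)
    simpa using tendsto_const_nhds.sub this
  · intro k
    simp only [Function.comp]
    positivity

/-- The random system with complete connections attached to the `N`-continued fraction map `T_N`:
states `[0,1]` with its Borel sets, events `i ≥ N`, `u(x, i) = N / (x + i)` and
`P(x, i) = (x + N) / ((x + i) (x + i + 1))`. -/
noncomputable def nCFSystem (N : ℕ) (hN : 1 ≤ N) : RSCC (Set.Icc (0 : ℝ) 1) (Set.Ici N) where
  nonempty_events := ⟨⟨N, le_refl N⟩⟩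
  u x i := ⟨N / ((x : ℝ) + ((i : ℕ) : ℝ)), by
    have hx := x.2.1
    have hi : (N : ℝ) ≤ ((i : ℕ) : ℝ) := by exact_mod_cast i.2
    exact ⟨by positivity, div_le_one_of_le₀ (by linarith) (by positivity)⟩⟩
  measurable_u i := by
    refine Measurable.subtype_mk ?_
    fun_prop
  P x i := ((x : ℝ) + N) / (((x : ℝ) + ((i : ℕ) : ℝ)) * ((x : ℝ) + ((i : ℕ) : ℝ) + 1))
  P_nonneg x i := by
    have hx := x.2.1
    positivity
  hasSum_P x := hasSum_nCF N hN x x.2.1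
  measurable_P i := by fun_prop

/-! The dependence of the delayed probabilities on the initial state decays geometrically. Peeling
off the first event, two initial states `x`, `y` differ in two ways: the next states differ, and so
do the weights of the events. On average the maps `u` contract: the mean of |u(x,i) - u(y,i)| under
P(x,·) is at most 2/3 |x - y|. The weights P(x,·) and P(y,·) are at ℓ¹ distance at most 4 |x - y|,
so the probability of any event is Lipschitz in the state with constant 12, the fixed point of L ↦
2L/3 + 4.

For a function of the next state alone, the weight term is handled better by summation by parts,
which costs L/4 instead of 4 (`abs_tsum_P_sub_mul_comp_u_le`). The transition operator thus
multiplies Lipschitz constants by 2/3 + 1/4 = 11/12 and gives the bound 12 (11/12)^m. Hence the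
delayed probabilities from a fixed state are Cauchy uniformly in `r` and `A`, and their limits are
probability measures. -/

/-- A set function that is a uniform limit of probability measures is a probability measure. -/
theorem exists_isProbabilityMeasure_of_uniform_limit {α : Type*} [MeasurableSpace α]
    (μ : ℕ → Measure α) [∀ n, IsProbabilityMeasure (μ n)] (c : Set α → ℝ) (e : ℕ → ℝ)
    (he : Tendsto e atTop (𝓝 0))
    (h : ∀ n A, MeasurableSet A → |(μ n).real A - c A| ≤ e n) :
    ∃ ν : Measure α, IsProbabilityMeasure ν ∧ ∀ A, MeasurableSet A → ν.real A = c A := by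
  have hlim : ∀ A, MeasurableSet A → Tendsto (fun n => (μ n).real A) atTop (𝓝 (c A)) := by
    intro A hA
    rw [tendsto_iff_dist_tendsto_zero]
    exact squeeze_zero (fun _ => dist_nonneg) (fun n => h n A hA) he
  have hnonneg : ∀ A, MeasurableSet A → 0 ≤ c A := fun A hA =>
    ge_of_tendsto' (hlim A hA) fun n => measureReal_nonneg
  have hempty : c ∅ = 0 := tendsto_nhds_unique (hlim ∅ .empty) (by simp)
  have huniv : c Set.univ = 1 := tendsto_nhds_unique (hlim _ .univ) (by simp)
  have hsum : ∀ f : ℕ → Set α, (∀ i, MeasurableSet (f i)) → Pairwise (Function.onFun Disjoint f) →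
      HasSum (fun i => c (f i)) (c (⋃ i, f i)) := by
    intro f hf hd
    rw [hasSum_iff_tendsto_nat_of_nonneg fun i => hnonneg _ (hf i)]
    have hpart : ∀ n k, ∑ i ∈ Finset.range k, (μ n).real (f i)
        = (μ n).real (⋃ i ∈ Finset.range k, f i) := fun n k =>
      (measureReal_biUnion_finset (fun i _ j _ hij => hd hij) fun i _ => hf i).symm
    have hmeas : ∀ k, MeasurableSet (⋃ i ∈ Finset.range k, f i) := fun k =>
      Finset.measurableSet_biUnion _ fun i _ => hf i
    have hfin : ∀ k, ∑ i ∈ Finset.range k, c (f i) = c (⋃ i ∈ Finset.range k, f i) := by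
      intro k
      refine tendsto_nhds_unique (tendsto_finsetSum _ fun i _ => hlim _ (hf i)) ?_
      simp only [hpart]
      exact hlim _ (hmeas k)
    have hμ : ∀ n, Tendsto (fun k => (μ n).real (⋃ i ∈ Finset.range k, f i)) atTop
        (𝓝 ((μ n).real (⋃ i, f i))) := by
      intro n
      have h1 : HasSum (fun i => (μ n).real (f i)) ((μ n).real (⋃ i, f i)) := by
        have := measure_iUnion (μ := μ n) hd hf
        rw [measureReal_def, this, ENNReal.tsum_toReal_eq fun i => measure_ne_top _ _]
        refine (ENNReal.summable_toReal ?_).hasSum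
        rw [← this]
        exact measure_ne_top _ _
      simpa only [hpart] using h1.tendsto_sum_nat
    simp only [hfin]
    rw [Metric.tendsto_atTop]
    intro ε hε
    -- The error `e n` is uniform in the set, so one `n` serves the union and all partial unions;
    -- continuity of `μ n` gives the last third.
    obtain ⟨n, hn⟩ := (he.eventually (gt_mem_nhds (show (0 : ℝ) < ε / 3 by positivity))).exists
    obtain ⟨K, hK⟩ := Metric.tendsto_atTop.1 (hμ n) (ε / 3) (by positivity)
    refine ⟨K, fun k hk => ?_⟩
    have h1 := abs_le.1 (h n _ (hmeas k))
    have h2 := abs_le.1 (h n _ (MeasurableSet.iUnion hf))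
    have h3 := abs_lt.1 (hK k hk)
    rw [Real.dist_eq, abs_lt]
    constructor <;> linarith
  refine ⟨Measure.ofMeasurable (fun A _ => ENNReal.ofReal (c A)) (by simp [hempty]) ?_, ?_, ?_⟩
  · intro f hf hd
    have := hsum f hf hd
    change ENNReal.ofReal (c (⋃ i, f i)) = ∑' i, ENNReal.ofReal (c (f i))
    rw [← this.tsum_eq, ENNReal.ofReal_tsum_of_nonneg (fun i => hnonneg _ (hf i)) this.summable]
  · constructor
    rw [Measure.ofMeasurable_apply _ .univ, huniv, ENNReal.ofReal_one]
  · intro A hA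
    rw [measureReal_def, Measure.ofMeasurable_apply _ hA, ENNReal.toReal_ofReal (hnonneg A hA)]

/-! ### Conditioning on the first event, and a geometric criterion for uniform ergodicity -/

namespace RSCC

variable {W X : Type*} [MeasurableSpace W] (S : RSCC W X)

theorem summable_P_mul (w : W) {g : X → ℝ} {M : ℝ} (hg : ∀ x, |g x| ≤ M) :
    Summable fun x => S.P w x * g x :=
  .of_norm_bounded ((S.hasSum_P w).summable.mul_right M) fun x => by
    rw [norm_mul, Real.norm_of_nonneg (S.P_nonneg w x)]
    exact mul_le_mul_of_nonneg_left (hg x) (S.P_nonneg w x)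

/-- The recursion defining `act` splits off the last event; the contraction argument needs the
first. -/
theorem act_cons (r : ℕ) (w : W) (i : X) (x : Fin r → X) :
    S.act (r + 1) w (Fin.cons i x) = S.act r (S.u w i) x := by
  induction r with
  | zero => simp [act]
  | succ r ih =>
    have hx : (Fin.init (Fin.cons i x : Fin (r + 1 + 1) → X) : Fin (r + 1) → X)
        = Fin.cons i (Fin.init x) := by
      rw [← Fin.snoc_init_self x, Fin.cons_snoc_eq_snoc_cons]; simp
    have hl : (Fin.cons i x : Fin (r + 1 + 1) → X) (Fin.last (r + 1)) = x (Fin.last r) := by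
      rw [← Fin.succ_last, Fin.cons_succ]
    conv_lhs => rw [act]
    conv_rhs => rw [act]
    rw [hx, hl, ih]

theorem pathProb_cons (r : ℕ) (w : W) (i : X) (x : Fin r → X) :
    S.pathProb (r + 1) w (Fin.cons i x) = S.P w i * S.pathProb r (S.u w i) x := by
  induction r with
  | zero => simp [pathProb, act]
  | succ r ih =>
    have hx : (Fin.init (Fin.cons i x : Fin (r + 1 + 1) → X) : Fin (r + 1) → X)
        = Fin.cons i (Fin.init x) := by
      rw [← Fin.snoc_init_self x, Fin.cons_snoc_eq_snoc_cons]; simp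
    have hl : (Fin.cons i x : Fin (r + 1 + 1) → X) (Fin.last (r + 1)) = x (Fin.last r) := by
      rw [← Fin.succ_last, Fin.cons_succ]
    conv_lhs => rw [pathProb]
    conv_rhs => rw [pathProb]
    rw [hx, hl, ih, act_cons, mul_assoc]

theorem pathProbSet_nonneg (r : ℕ) (w : W) (A : Set (Fin r → X)) : 0 ≤ S.pathProbSet r w A :=
  tsum_nonneg fun _ => S.pathProb_nonneg _ _ _

theorem pathProbSet_le_one (r : ℕ) (w : W) (A : Set (Fin r → X)) : S.pathProbSet r w A ≤ 1 :=
  ((S.hasSum_pathProb r w).summable.tsum_subtype_le _ A (S.pathProb_nonneg r w)).trans_eq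
    (S.hasSum_pathProb r w).tsum_eq

theorem abs_pathProbSet_le_one (r : ℕ) (w : W) (A : Set (Fin r → X)) :
    |S.pathProbSet r w A| ≤ 1 := by
  rw [abs_of_nonneg (S.pathProbSet_nonneg r w A)]
  exact S.pathProbSet_le_one r w A

/-- Conditioning on the first event. -/
theorem pathProbSet_eq_tsum {n r : ℕ} (h : n = r + 1) (w : W) (A : Set (Fin n → X)) :
    S.pathProbSet n w A = ∑' i, S.P w i * S.pathProbSet r (S.u w i)
      {x | (fun j => (Fin.cons i x : Fin (r + 1) → X) (Fin.cast h j)) ∈ A} := by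
  subst h
  simp only [Fin.cast_eq_self, pathProbSet, tsum_subtype]
  have hs : Summable (A.indicator (S.pathProb (r + 1) w)) :=
    (S.hasSum_pathProb _ w).summable.indicator A
  rw [← (Fin.consEquiv fun _ : Fin (r + 1) => X).tsum_eq]
  rw [← (Fin.consEquiv fun _ : Fin (r + 1) => X).summable_iff] at hs
  refine (hs.tsum_prod).trans (tsum_congr fun i => ?_)
  rw [← tsum_mul_left]
  refine tsum_congr fun x => ?_
  by_cases hx : (Fin.cons i x : Fin (r + 1) → X) ∈ A <;>
    simp [Fin.consEquiv, Set.indicator, hx, pathProb_cons]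

/-- One more unit of delay is one application of the transition operator. Delays start at 1, which
keeps the subtraction in `n - 1` from truncating. -/
theorem delayedProb_succ (m r : ℕ) (w : W) (A : Set (Fin r → X)) :
    S.delayedProb (m + 2) r w A = ∑' i, S.P w i * S.delayedProb (m + 1) r (S.u w i) A := by
  have h : m + 1 + r = m + r + 1 := by omega
  refine (S.pathProbSet_eq_tsum h w _).trans (tsum_congr fun i => ?_)
  congr 2
  ext x
  have : ∀ j : Fin r, Fin.cast h (Fin.natAdd (m + 1) j) = (Fin.natAdd m j).succ := by
    intro j; ext; simp; omega
  simp only [Set.mem_ofPred_eq]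
  change (fun j : Fin r => (Fin.cons i x : Fin (m + r + 1) → X)
    (Fin.cast h (Fin.natAdd (m + 1) j))) ∈ A ↔ _
  simp only [this, Fin.cons_succ]
  rfl

theorem abs_delayedProb_le_one (n r : ℕ) (w : W) (A : Set (Fin r → X)) :
    |S.delayedProb n r w A| ≤ 1 := S.abs_pathProbSet_le_one _ _ _

theorem exists_measure_delayedProb (n r : ℕ) (w : W) :
    ∃ μ : @Measure (Fin r → X) ⊤, @IsProbabilityMeasure _ ⊤ μ ∧
      ∀ A, @Measure.real _ ⊤ μ A = S.delayedProb n r w A := by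
  let : MeasurableSpace (Fin r → X) := ⊤
  let : MeasurableSpace (Fin (n - 1 + r) → X) := ⊤
  have hp : HasSum (fun x => ENNReal.ofReal (S.pathProb (n - 1 + r) w x)) 1 := by
    have h := S.hasSum_pathProb (n - 1 + r) w
    rw [← ENNReal.ofReal_one, ← h.tsum_eq,
      ENNReal.ofReal_tsum_of_nonneg (S.pathProb_nonneg _ w) h.summable]
    exact ENNReal.summable.hasSum
  let p : PMF (Fin (n - 1 + r) → X) := ⟨_, hp⟩
  let t : (Fin (n - 1 + r) → X) → (Fin r → X) := fun x j => x (Fin.natAdd (n - 1) j)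
  have ht : Measurable t := measurable_from_top
  refine ⟨p.toMeasure.map t, Measure.isProbabilityMeasure_map ht.aemeasurable, fun A => ?_⟩
  have hA : MeasurableSet A := trivial
  rw [map_measureReal_apply ht hA, measureReal_def,
    p.toMeasure_apply (ht hA), ← tsum_subtype, ENNReal.tsum_toReal_eq]
  · exact tsum_congr fun x => ENNReal.toReal_ofReal (S.pathProb_nonneg _ _ _)
  · exact fun x => ENNReal.ofReal_ne_top

theorem abs_tsum_P_mul_sub_le (w : W) {g : X → ℝ} {M b ε : ℝ} (hg : ∀ x, |g x| ≤ M)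
    (h : ∀ x, |g x - b| ≤ ε) : |∑' x, S.P w x * g x - b| ≤ ε := by
  have h1 := (S.summable_P_mul w hg).hasSum.sub ((S.hasSum_P w).mul_right b)
  rw [one_mul] at h1
  have h2 := (S.hasSum_P w).mul_right ε
  rw [one_mul] at h2
  rw [← h1.tsum_eq, ← Real.norm_eq_abs]
  refine tsum_of_norm_bounded h2 fun x => ?_
  rw [← mul_sub, norm_mul, Real.norm_of_nonneg (S.P_nonneg w x)]
  exact mul_le_mul_of_nonneg_left (h x) (S.P_nonneg w x)

/-- If the dependence of the delayed probabilities on the initial state decays geometrically,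
uniformly in the length of the strings and in the set, then the system is uniformly ergodic. -/
theorem uniformlyErgodic_of_geometric [Nonempty W] {K q : ℝ} (hq0 : 0 ≤ q) (hq : q < 1)
    (h : ∀ m r w w' (A : Set (Fin r → X)),
      |S.delayedProb (m + 1) r w A - S.delayedProb (m + 1) r w' A| ≤ K * q ^ m) :
    S.UniformlyErgodic := by
  obtain ⟨w₀⟩ := ‹Nonempty W›
  have hstep : ∀ r (A : Set (Fin r → X)) m,
      dist (S.delayedProb (m + 1) r w₀ A) (S.delayedProb (m + 1 + 1) r w₀ A) ≤ K * q ^ m := by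
    intro r A m
    rw [dist_comm, Real.dist_eq, delayedProb_succ]
    exact S.abs_tsum_P_mul_sub_le w₀ (fun i => S.abs_delayedProb_le_one _ _ _ _)
      fun i => h m r _ _ A
  have hc : ∀ r (A : Set (Fin r → X)), ∃ a,
      Tendsto (fun m => S.delayedProb (m + 1) r w₀ A) atTop (𝓝 a) := fun r A =>
    cauchySeq_tendsto_of_complete (cauchySeq_of_le_geometric q K hq (hstep r A))
  choose c hc using hc
  have herr : ∀ r (A : Set (Fin r → X)) m,
      |S.delayedProb (m + 1) r w₀ A - c r A| ≤ K * q ^ m / (1 - q) := fun r A m =>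
    dist_le_of_le_geometric_of_tendsto q K hq (hstep r A) (hc r A) m
  have hpow : Tendsto (fun m : ℕ => q ^ m) atTop (𝓝 0) :=
    tendsto_pow_atTop_nhds_zero_of_lt_one hq0 hq
  have hlim : ∀ r, ∃ ν : @Measure (Fin r → X) ⊤, @IsProbabilityMeasure _ ⊤ ν ∧
      ∀ A, @Measure.real _ ⊤ ν A = c r A := by
    intro r
    let : MeasurableSpace (Fin r → X) := ⊤
    choose μ hμ hμA using fun m => S.exists_measure_delayedProb (m + 1) r w₀
    obtain ⟨ν, hν, hνA⟩ := exists_isProbabilityMeasure_of_uniform_limit μ (c r)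
      (fun m => K * q ^ m / (1 - q)) (by simpa using (hpow.const_mul K).div_const (1 - q))
      fun n A _ => by rw [hμA]; exact herr r A n
    exact ⟨ν, hν, fun A => hνA A trivial⟩
  choose ν hν hνA using hlim
  refine ⟨ν, fun r _ => hν r, ?_⟩
  -- The estimates concern delays `m + 1`; the delay 0 is dropped.
  rw [← tendsto_add_atTop_iff_nat 1]
  have hb : Tendsto (fun m : ℕ => ENNReal.ofReal (K * q ^ m + K * q ^ m / (1 - q))) atTop
      (𝓝 0) := by
    rw [← ENNReal.ofReal_zero]
    refine ENNReal.tendsto_ofReal ?_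
    simpa using (hpow.const_mul K).add ((hpow.const_mul K).div_const (1 - q))
  refine tendsto_of_tendsto_of_tendsto_of_le_of_le tendsto_const_nhds hb (fun _ => bot_le)
    fun m => ?_
  refine iSup_le fun w => iSup_le fun r => iSup_le fun _ => iSup_le fun A =>
    ENNReal.ofReal_le_ofReal ?_
  have h1 := hνA r A
  rw [measureReal_def] at h1
  rw [h1]
  exact (abs_sub_le _ _ _).trans (add_le_add (h m r w w₀ A) (herr r A m))

end RSCC

/-! ### Bounds for series by telescoping majorants -/

theorem abs_tsum_le_of_le_telescoping {a D : ℕ → ℝ} (hD : ∀ k, 0 ≤ D k)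
    (h : ∀ k, |a k| ≤ D k - D (k + 1)) : |∑' k, a k| ≤ D 0 := by
  have hb : ∀ n, ∑ k ∈ Finset.range n, |a k| ≤ D 0 := fun n => by
    refine (Finset.sum_le_sum fun k _ => h k).trans ?_
    rw [Finset.sum_range_sub']
    linarith [hD n]
  have hs : Summable fun k => |a k| := summable_of_sum_range_le (fun _ => abs_nonneg _) hb
  exact (tsum_of_norm_bounded hs.hasSum fun k => (Real.norm_eq_abs _).le).trans
    (Real.tsum_le_of_sum_range_le (fun _ => abs_nonneg _) hb)

/-- Summation by parts. -/
theorem abs_tsum_sub_mul_le_of_le_telescoping {d g D : ℕ → ℝ} {M : ℝ} (hd0 : d 0 = 0)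
    (hd : Tendsto d atTop (𝓝 0)) (hg : ∀ k, |g k| ≤ M)
    (hs : Summable fun k => (d k - d (k + 1)) * g k) (hD : ∀ k, 0 ≤ D k)
    (h : ∀ k, |d (k + 1) * (g (k + 1) - g k)| ≤ D k - D (k + 1)) :
    |∑' k, (d k - d (k + 1)) * g k| ≤ D 0 := by
  have hparts : ∀ n, ∑ k ∈ Finset.range n, (d k - d (k + 1)) * g k
      = -(d n * g n) + ∑ k ∈ Finset.range n, d (k + 1) * (g (k + 1) - g k) := by
    intro n
    induction n with
    | zero => simp [hd0]
    | succ n ih => rw [Finset.sum_range_succ, Finset.sum_range_succ, ih]; ring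
  have hsum : ∀ n, |∑ k ∈ Finset.range n, d (k + 1) * (g (k + 1) - g k)| ≤ D 0 := by
    intro n
    refine (Finset.abs_sum_le_sum_abs _ _).trans ((Finset.sum_le_sum fun k _ => h k).trans ?_)
    rw [Finset.sum_range_sub']
    linarith [hD n]
  -- The boundary term vanishes in the limit, so `M` does not enter the bound.
  have hdg : Tendsto (fun n => |d n * g n|) atTop (𝓝 0) := by
    refine squeeze_zero (fun _ => abs_nonneg _) (g := fun n => |d n| * M) (fun n => ?_)
      (by simpa using hd.abs.mul_const M)
    rw [abs_mul]
    exact mul_le_mul_of_nonneg_left (hg n) (abs_nonneg _)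
  have hlim := hdg.add_const (D 0)
  rw [zero_add] at hlim
  refine le_of_tendsto_of_tendsto' hs.hasSum.tendsto_sum_nat.abs hlim fun n => ?_
  rw [hparts]
  refine (abs_add_le _ _).trans ?_
  rw [abs_neg]
  exact add_le_add_right (hsum n) _

/-- The enumeration `N, N + 1, …` of the event space. -/
def iciEquiv (N : ℕ) : ℕ ≃ Set.Ici N where
  toFun k := ⟨N + k, Nat.le_add_right N k⟩
  invFun i := (i : ℕ) - N
  left_inv k := by simp
  right_inv i := Subtype.ext (Nat.add_sub_cancel' i.2)

/-! ### Estimates for the maps and weights of the continued fraction system -/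

namespace nCFSystem

variable {N : ℕ} (hN : 1 ≤ N)

theorem P_iciEquiv (x : Set.Icc (0 : ℝ) 1) (k : ℕ) : (nCFSystem N hN).P x (iciEquiv N k)
    = (x + N) / ((x + N + k) * (x + N + k + 1)) := by
  simp [nCFSystem, iciEquiv, add_assoc]

theorem u_iciEquiv (x : Set.Icc (0 : ℝ) 1) (k : ℕ) :
    ((nCFSystem N hN).u x (iciEquiv N k) : ℝ) = N / (x + N + k) := by
  simp [nCFSystem, iciEquiv, add_assoc]

theorem tsum_P_mul_eq (x : Set.Icc (0 : ℝ) 1) (g : Set.Ici N → ℝ) :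
    ∑' i, (nCFSystem N hN).P x i * g i
      = ∑' k, (nCFSystem N hN).P x (iciEquiv N k) * g (iciEquiv N k) :=
  ((iciEquiv N).tsum_eq _).symm

theorem abs_P_mul_u_sub_le (x y : Set.Icc (0 : ℝ) 1) (k : ℕ) :
    (nCFSystem N hN).P x (iciEquiv N k) *
      |((nCFSystem N hN).u x (iciEquiv N k) : ℝ) - (nCFSystem N hN).u y (iciEquiv N k)|
    ≤ |(x : ℝ) - y| * (2 / 3 * (N / (N + k)) ^ 2 - 2 / 3 * (N / (N + (k + 1 : ℕ))) ^ 2) := by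
  rw [P_iciEquiv, u_iciEquiv, u_iciEquiv]
  obtain ⟨x, hx0, hx1⟩ := x
  obtain ⟨y, hy0, hy1⟩ := y
  have hn : (1 : ℝ) ≤ N := by exact_mod_cast hN
  have hk : (0 : ℝ) ≤ k := k.cast_nonneg
  push_cast
  generalize (N : ℝ) = n at *
  generalize (k : ℝ) = k at *
  have hu : n / (x + n + k) - n / (y + n + k) = (y - x) * (n / ((x + n + k) * (y + n + k))) := by
    have : x + n + k ≠ 0 := by positivity
    have : y + n + k ≠ 0 := by positivity
    field_simp
    ring
  rw [hu, abs_mul, abs_sub_comm y x,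
    abs_of_nonneg (show 0 ≤ n / ((x + n + k) * (y + n + k)) by positivity), mul_left_comm]
  refine mul_le_mul_of_nonneg_left ?_ (abs_nonneg _)
  -- This factor increases with `x`, so it is bounded by its value at 1; the remaining factors are
  -- bounded by their values at 0.
  have hT : (x + n) / (x + n + k) ≤ (n + 1) / (n + k + 1) := by
    rw [div_le_div_iff₀ (by positivity) (by positivity)]
    nlinarith [mul_nonneg hk (by linarith : 0 ≤ 1 - x)]
  calc (x + n) / ((x + n + k) * (x + n + k + 1)) * (n / ((x + n + k) * (y + n + k)))
      = (x + n) / (x + n + k) * (n / ((x + n + k + 1) * ((x + n + k) * (y + n + k)))) := by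
        field_simp
    _ ≤ (n + 1) / (n + k + 1) * (n / ((n + k + 1) * ((n + k) * (n + k)))) := by
        gcongr <;> linarith
    _ ≤ _ := by
        have : 2 / 3 * (n / (n + k)) ^ 2 - 2 / 3 * (n / (n + (k + 1))) ^ 2
            - (n + 1) / (n + k + 1) * (n / ((n + k + 1) * ((n + k) * (n + k))))
            = n * (2 / 3 * n * (2 * (n + k) + 1) - (n + 1)) / ((n + k) ^ 2 * (n + k + 1) ^ 2) := by
          rw [← add_assoc n k 1]
          have : n + k ≠ 0 := by positivity
          have : n + k + 1 ≠ 0 := by positivity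
          field_simp
          ring
        rw [← sub_nonneg, this]
        -- Equality at n = 1, k = 0: this is where 2/3 comes from.
        have : 0 ≤ 2 / 3 * n * (2 * (n + k) + 1) - (n + 1) := by
          nlinarith [mul_nonneg (by linarith : 0 ≤ n) hk]
        positivity

theorem abs_P_sub_P_le (x y : Set.Icc (0 : ℝ) 1) (k : ℕ) :
    |(nCFSystem N hN).P x (iciEquiv N k) - (nCFSystem N hN).P y (iciEquiv N k)|
    ≤ 4 * |(x : ℝ) - y| * (nCFSystem N hN).P 0 (iciEquiv N k) := by
  simp only [P_iciEquiv]
  obtain ⟨x, hx0, hx1⟩ := x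
  obtain ⟨y, hy0, hy1⟩ := y
  have hn : (1 : ℝ) ≤ N := by exact_mod_cast hN
  have hk : (0 : ℝ) ≤ k := k.cast_nonneg
  simp only [Set.Icc.coe_zero, zero_add]
  generalize (N : ℝ) = n at *
  generalize (k : ℝ) = k at *
  have hP : (x + n) / ((x + n + k) * (x + n + k + 1)) - (y + n) / ((y + n + k) * (y + n + k + 1))
      = (x - y) * ((k * (x + y + 2 * (n + k) + 1) - (x + n + k) * (y + n + k))
        / ((x + n + k) * (x + n + k + 1) * ((y + n + k) * (y + n + k + 1)))) := by
    have : x + n + k ≠ 0 := by positivity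
    have : x + n + k + 1 ≠ 0 := by positivity
    have : y + n + k ≠ 0 := by positivity
    have : y + n + k + 1 ≠ 0 := by positivity
    field_simp
    ring
  rw [hP, abs_mul, mul_comm 4, mul_assoc |x - y|]
  refine mul_le_mul_of_nonneg_left ?_ (abs_nonneg (x - y))
  have hnum : |k * (x + y + 2 * (n + k) + 1) - (x + n + k) * (y + n + k)|
      ≤ 2 * ((x + n + k + 1) * (y + n + k + 1)) := by
    rw [abs_le]
    constructor <;> nlinarith [mul_nonneg hx0 hy0, mul_nonneg hx0 hk, mul_nonneg hy0 hk,
      mul_nonneg hx0 (by linarith : 0 ≤ n), mul_nonneg hy0 (by linarith : 0 ≤ n),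
      mul_nonneg hk (by linarith : 0 ≤ n)]
  rw [abs_div, abs_of_nonneg (show 0 ≤ (x + n + k) * (x + n + k + 1) *
    ((y + n + k) * (y + n + k + 1)) by positivity)]
  calc _ ≤ 2 * ((x + n + k + 1) * (y + n + k + 1)) / ((x + n + k) * (x + n + k + 1) *
        ((y + n + k) * (y + n + k + 1))) := by gcongr
    _ = 2 / ((x + n + k) * (y + n + k)) := by field_simp
    _ ≤ 2 / ((n + k) * (n + k)) := by gcongr <;> linarith
    _ ≤ _ := by
      -- What remains amounts to n + k + 1 ≤ 2n(n + k), true since n ≥ 1.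
      rw [mul_div_assoc', div_le_div_iff₀ (by positivity) (by positivity)]
      nlinarith [mul_nonneg (by linarith : 0 ≤ n + k)
        (mul_nonneg hk (by linarith : 0 ≤ n)), mul_nonneg hk hk, mul_nonneg (by linarith : 0 ≤ n + k)
        (mul_nonneg (by linarith : 0 ≤ n) (by linarith : 0 ≤ n - 1)),
        mul_nonneg (by linarith : 0 ≤ n + k) (by nlinarith : 0 ≤ 2 * n * (n + k) - (n + k + 1) + 1)]

theorem abs_tsum_P_mul_sub_le {L : ℝ} (hL : 0 ≤ L) (x y : Set.Icc (0 : ℝ) 1)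
    (f : Set.Ici N → Set.Icc (0 : ℝ) 1 → ℝ) (hf : ∀ i a b, |f i a - f i b| ≤ L * |(a : ℝ) - b|) :
    |∑' i, (nCFSystem N hN).P x i *
      (f i ((nCFSystem N hN).u x i) - f i ((nCFSystem N hN).u y i))|
    ≤ 2 / 3 * L * |(x : ℝ) - y| := by
  rw [tsum_P_mul_eq]
  refine (abs_tsum_le_of_le_telescoping
    (D := fun k => L * |(x : ℝ) - y| * (2 / 3 * (N / (N + k)) ^ 2))
    (fun k => by positivity) fun k => ?_).trans_eq ?_
  · rw [abs_mul, abs_of_nonneg ((nCFSystem N hN).P_nonneg _ _)]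
    calc _ ≤ (nCFSystem N hN).P x (iciEquiv N k) * (L * |((nCFSystem N hN).u x (iciEquiv N k) : ℝ)
          - (nCFSystem N hN).u y (iciEquiv N k)|) :=
          mul_le_mul_of_nonneg_left (hf _ _ _) ((nCFSystem N hN).P_nonneg _ _)
      _ = L * ((nCFSystem N hN).P x (iciEquiv N k) * |((nCFSystem N hN).u x (iciEquiv N k) : ℝ)
          - (nCFSystem N hN).u y (iciEquiv N k)|) := by ring
      _ ≤ L * _ := mul_le_mul_of_nonneg_left (abs_P_mul_u_sub_le hN x y k) hL
      _ = _ := by ring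
  · have : (N : ℝ) ≠ 0 := by exact_mod_cast (by omega : N ≠ 0)
    simp [this]
    ring

theorem abs_tsum_P_sub_mul_le (x y : Set.Icc (0 : ℝ) 1) (g : Set.Ici N → ℝ)
    (hg : ∀ i, |g i| ≤ 1) :
    |∑' i, ((nCFSystem N hN).P x i - (nCFSystem N hN).P y i) * g i| ≤ 4 * |(x : ℝ) - y| := by
  have h := ((nCFSystem N hN).hasSum_P 0).mul_left (4 * |(x : ℝ) - y|)
  rw [mul_one] at h
  rw [← Real.norm_eq_abs]
  refine tsum_of_norm_bounded h fun i => ?_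
  obtain ⟨k, rfl⟩ := (iciEquiv N).surjective i
  rw [norm_mul]
  exact (mul_le_of_le_one_right (norm_nonneg _) (hg _)).trans (abs_P_sub_P_le hN x y k)

/-- Consecutive states u(y,i), u(y,i+1) are close, so summation by parts trades the size of `f` for
its Lipschitz constant. -/
theorem abs_tsum_P_sub_mul_comp_u_le {L : ℝ} (hL : 0 ≤ L) (x y : Set.Icc (0 : ℝ) 1)
    (f : Set.Icc (0 : ℝ) 1 → ℝ) (hf1 : ∀ a, |f a| ≤ 1)
    (hf : ∀ a b, |f a - f b| ≤ L * |(a : ℝ) - b|) :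
    |∑' i, ((nCFSystem N hN).P x i - (nCFSystem N hN).P y i) * f ((nCFSystem N hN).u y i)|
    ≤ 1 / 4 * L * |(x : ℝ) - y| := by
  have hn : (1 : ℝ) ≤ N := by exact_mod_cast hN
  obtain ⟨hx0, hx1⟩ := x.2
  obtain ⟨hy0, hy1⟩ := y.2
  -- The difference of the tails: (x + N)/(x + N + k) is the P(x,·)-mass of the events i ≥ N + k.
  let d : ℕ → ℝ := fun k => (x + N) / (x + N + k) - (y + N) / (y + N + k)
  have hd : ∀ k : ℕ, d k = ((x : ℝ) - y) * (k / ((x + N + k) * (y + N + k))) := by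
    intro k
    have : (x : ℝ) + N + k ≠ 0 := by positivity
    have : (y : ℝ) + N + k ≠ 0 := by positivity
    simp only [d]
    field_simp
    ring
  have hdP : ∀ k, (nCFSystem N hN).P x (iciEquiv N k) - (nCFSystem N hN).P y (iciEquiv N k)
      = d k - d (k + 1) := by
    intro k
    rw [P_iciEquiv, P_iciEquiv]
    simp only [d]
    push_cast
    have : (x : ℝ) + N + k ≠ 0 := by positivity
    have : (x : ℝ) + N + (k + 1) ≠ 0 := by positivity
    have : (x : ℝ) + N + k + 1 ≠ 0 := by positivity
    have : (y : ℝ) + N + k ≠ 0 := by positivity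
    have : (y : ℝ) + N + (k + 1) ≠ 0 := by positivity
    have : (y : ℝ) + N + k + 1 ≠ 0 := by positivity
    have hT : ∀ z : ℝ, z + N + k ≠ 0 → z + N + (k + 1) ≠ 0 →
        (z + N) / ((z + N + k) * (z + N + k + 1))
        = (z + N) / (z + N + k) - (z + N) / (z + N + (k + 1)) := by
      intro z h1 h2
      rw [← add_assoc] at h2 ⊢
      field_simp
      ring
    rw [hT x (by positivity) (by positivity), hT y (by positivity) (by positivity)]
    ring
  rw [← (iciEquiv N).tsum_eq]
  simp only [hdP]
  refine (abs_tsum_sub_mul_le_of_le_telescoping (M := 1)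
    (D := fun k => L * |(x : ℝ) - y| * (1 / 2 * (N / ((N + k) * (N + k + 1)))))
    (by simp [hd]) ?_ (fun k => hf1 _) ?_ (fun k => by positivity) fun k => ?_).trans ?_
  · have h : ∀ z : ℝ, Tendsto (fun k : ℕ => (z + N) / (z + N + k)) atTop (𝓝 0) := fun z =>
      tendsto_const_nhds.div_atTop
        (tendsto_atTop_add_const_left _ _ tendsto_natCast_atTop_atTop)
    simpa using (h x).sub (h y)
  · simp only [← hdP]
    refine (((iciEquiv N).summable_iff.2 ((nCFSystem N hN).hasSum_P x).summable).sub
      ((iciEquiv N).summable_iff.2 ((nCFSystem N hN).hasSum_P y).summable)).abs.of_norm_bounded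
      fun k => ?_
    rw [norm_mul]
    exact mul_le_of_le_one_right (norm_nonneg _) (hf1 _)
  · rw [abs_mul, hd, abs_mul]
    refine (mul_le_mul_of_nonneg_left (hf _ _) (by positivity)).trans ?_
    rw [u_iciEquiv, u_iciEquiv]
    have hk : (0 : ℝ) ≤ k := k.cast_nonneg
    push_cast
    generalize (N : ℝ) = n at *
    generalize (x : ℝ) = x at *
    generalize (y : ℝ) = y at *
    generalize (k : ℝ) = k at *
    have hu : n / (y + n + (k + 1)) - n / (y + n + k)
        = -(n / ((y + n + (k + 1)) * (y + n + k))) := by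
      have : y + n + k ≠ 0 := by positivity
      have : y + n + (k + 1) ≠ 0 := by positivity
      field_simp
      ring
    rw [hu, abs_neg, abs_of_nonneg (show 0 ≤ n / ((y + n + (k + 1)) * (y + n + k)) by positivity),
      abs_of_nonneg (show 0 ≤ (k + 1) / ((x + n + (k + 1)) * (y + n + (k + 1))) by positivity)]
    calc _ = L * |x - y| * ((k + 1) / ((x + n + (k + 1)) * (y + n + (k + 1))) *
          (n / ((y + n + (k + 1)) * (y + n + k)))) := by ring
      _ ≤ L * |x - y| * ((k + 1) / ((n + (k + 1)) * (n + (k + 1))) *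
          (n / ((n + (k + 1)) * (n + k)))) := by gcongr <;> linarith
      _ ≤ L * |x - y| * ((n + k) / ((n + (k + 1)) * (n + (k + 1))) *
          (n / ((n + (k + 1)) * (n + k)))) := by
        have : k + 1 ≤ n + k := by linarith
        gcongr L * |x - y| * (?_ / _ * _)
      -- With t = n + k, this is 1/(t+1)³ ≤ 1/(t(t+1)(t+2)), and the right side telescopes.
      _ ≤ L * |x - y| * (1 / 2 * (n / ((n + k) * (n + k + 1))) -
          1 / 2 * (n / ((n + (k + 1)) * (n + (k + 1) + 1)))) := by
        refine mul_le_mul_of_nonneg_left ?_ (by positivity)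
        have : 1 / 2 * (n / ((n + k) * (n + k + 1)))
            - 1 / 2 * (n / ((n + (k + 1)) * (n + (k + 1) + 1)))
            - (n + k) / ((n + (k + 1)) * (n + (k + 1))) * (n / ((n + (k + 1)) * (n + k)))
            = n / ((n + k) * (n + k + 1) ^ 3 * (n + k + 2)) := by
          rw [show n + (k + 1) + 1 = n + k + 2 by ring, ← add_assoc n k 1]
          have : n + k ≠ 0 := by positivity
          have : n + k + 1 ≠ 0 := by positivity
          have : n + k + 2 ≠ 0 := by positivity
          field_simp
          ring
        rw [← sub_nonneg, this]
        positivity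
      _ = _ := by ring
  -- The total is 1/(2(N + 1)), largest at N = 1.
  · have : (1 / 2 * ((N : ℝ) / ((N + (0 : ℕ)) * (N + (0 : ℕ) + 1)))) ≤ 1 / 4 := by
      simp only [Nat.cast_zero, add_zero]
      have : (N : ℝ) / (N * (N + 1)) ≤ 1 / 2 := by
        rw [div_le_div_iff₀ (by positivity) (by positivity)]
        nlinarith
      linarith
    refine (mul_le_mul_of_nonneg_left this (by positivity)).trans_eq (by ring)

end nCFSystem

/-! ### Propagation of Lipschitz bounds -/

namespace nCFSystem

variable {N : ℕ} (hN : 1 ≤ N)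

theorem tsum_P_mul_comp_u_sub (x y : Set.Icc (0 : ℝ) 1) (f : Set.Ici N → Set.Icc (0 : ℝ) 1 → ℝ)
    (hf1 : ∀ i a, |f i a| ≤ 1) :
    ∑' i, (nCFSystem N hN).P x i * f i ((nCFSystem N hN).u x i)
      - ∑' i, (nCFSystem N hN).P y i * f i ((nCFSystem N hN).u y i)
    = ∑' i, (nCFSystem N hN).P x i *
        (f i ((nCFSystem N hN).u x i) - f i ((nCFSystem N hN).u y i))
      + ∑' i, ((nCFSystem N hN).P x i - (nCFSystem N hN).P y i) *
        f i ((nCFSystem N hN).u y i) := by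
  have h : ∀ a b, Summable fun i => (nCFSystem N hN).P a i * f i ((nCFSystem N hN).u b i) :=
    fun a b => (nCFSystem N hN).summable_P_mul a fun i => hf1 i _
  simp only [mul_sub, sub_mul]
  rw [(h x x).tsum_sub (h x y), (h x y).tsum_sub (h y y)]
  ring

/-- The path probabilities are Lipschitz in the initial state, uniformly in the length of the
strings and in the set. -/
theorem abs_pathProbSet_sub_le (r : ℕ) (x y : Set.Icc (0 : ℝ) 1) (A : Set (Fin r → Set.Ici N)) :
    |(nCFSystem N hN).pathProbSet r x A - (nCFSystem N hN).pathProbSet r y A|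
      ≤ 12 * |(x : ℝ) - y| := by
  induction r generalizing x y with
  | zero =>
    simp only [RSCC.pathProbSet, RSCC.pathProb, sub_self, abs_zero]
    positivity
  | succ r ih =>
    -- The function depends on `i`, since the event left after conditioning does; summation by parts
    -- is unavailable and the ℓ¹ bound is used, with 2/3 · 12 + 4 = 12.
    have key : ∀ f : Set.Ici N → Set.Icc (0 : ℝ) 1 → ℝ, (∀ i a, |f i a| ≤ 1) →
        (∀ i a b, |f i a - f i b| ≤ 12 * |(a : ℝ) - b|) →
        |∑' i, (nCFSystem N hN).P x i * f i ((nCFSystem N hN).u x i)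
          - ∑' i, (nCFSystem N hN).P y i * f i ((nCFSystem N hN).u y i)| ≤ 12 * |(x : ℝ) - y| := by
      intro f hf1 hf
      rw [tsum_P_mul_comp_u_sub hN x y f hf1]
      refine (abs_add_le _ _).trans ((add_le_add
        (abs_tsum_P_mul_sub_le hN (by norm_num) x y f hf)
        (abs_tsum_P_sub_mul_le hN x y _ fun i => hf1 i _)).trans_eq ?_)
      ring
    rw [RSCC.pathProbSet_eq_tsum _ rfl, RSCC.pathProbSet_eq_tsum _ rfl]
    exact key (fun i a => (nCFSystem N hN).pathProbSet r a
        {z | (fun j => (Fin.cons i z : Fin (r + 1) → Set.Ici N) (Fin.cast rfl j)) ∈ A})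
      (fun i a => RSCC.abs_pathProbSet_le_one _ _ _ _) fun i a b => ih a b _

/-- The transition operator contracts Lipschitz constants. -/
theorem abs_tsum_P_mul_comp_u_sub_le {L : ℝ} (hL : 0 ≤ L) (x y : Set.Icc (0 : ℝ) 1)
    (f : Set.Icc (0 : ℝ) 1 → ℝ) (hf1 : ∀ a, |f a| ≤ 1)
    (hf : ∀ a b, |f a - f b| ≤ L * |(a : ℝ) - b|) :
    |∑' i, (nCFSystem N hN).P x i * f ((nCFSystem N hN).u x i)
      - ∑' i, (nCFSystem N hN).P y i * f ((nCFSystem N hN).u y i)|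
    ≤ L * (11 / 12) * |(x : ℝ) - y| := by
  rw [tsum_P_mul_comp_u_sub hN x y (fun _ => f) fun _ => hf1]
  refine (abs_add_le _ _).trans ((add_le_add
    (abs_tsum_P_mul_sub_le hN hL x y (fun _ => f) fun _ => hf)
    (abs_tsum_P_sub_mul_comp_u_le hN hL x y f hf1 hf)).trans_eq ?_)
  ring

theorem abs_delayedProb_sub_le (m r : ℕ) (x y : Set.Icc (0 : ℝ) 1)
    (A : Set (Fin r → Set.Ici N)) :
    |(nCFSystem N hN).delayedProb (m + 1) r x A - (nCFSystem N hN).delayedProb (m + 1) r y A|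
      ≤ 12 * (11 / 12) ^ m * |(x : ℝ) - y| := by
  induction m generalizing x y with
  | zero =>
    rw [pow_zero, mul_one]
    exact abs_pathProbSet_sub_le hN _ x y _
  | succ m ih =>
    rw [RSCC.delayedProb_succ, RSCC.delayedProb_succ, pow_succ, ← mul_assoc]
    exact abs_tsum_P_mul_comp_u_sub_le hN (by positivity) x y _
      (fun a => RSCC.abs_delayedProb_le_one _ _ _ _ _) ih

end nCFSystem

theorem proposition3p3 (N : ℕ) (hN : 1 ≤ N) : (nCFSystem N hN).UniformlyErgodic := by
  refine RSCC.uniformlyErgodic_of_geometric _ (K := 12) (q := 11 / 12) (by norm_num) (by norm_num)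
    fun m r x y A => (nCFSystem.abs_delayedProb_sub_le hN m r x y A).trans ?_
  refine mul_le_of_le_one_right (by positivity) (abs_le.2 ⟨?_, ?_⟩)
  · linarith [x.2.1, y.2.2]
  · linarith [x.2.2, y.2.1]
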